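/- Let $A$ be a unital complex $C^*$-algebra. An element $x\in A$ is *regular* if $x=xzx$ for some $z\in A$. Every regular $x$ has a unique Moore–Penrose inverse $x^\dagger$, i.e. the element $y$ with $x=xyx$, $y=yxy$, $(xy)^*=xy$, $(yx)^*=yx$. For $b,c\in A$, an element $a\in A$ is *$(b,c)$-invertible* if there is $y\in A$ with $y\in (bAy)\cap(yAc)$, $b=yab$ and $c=cay$; such a $y$ is unique and is denoted $a^{-(b,c)}$. **Theorem.** Let $a\in A$ and let $b,c\in A$ be regular elements such that $a$ is $(b,c)$-invertible and $a^{-(b,c)}\neq 0$. Let $(a_n)_{n\in\mathbb N}$, $(b_n)_{n\in\mathbb N}$, $(c_n)_{n\in\mathbb N}$ be sequences in $A$ such that, for every $n$, $b_n$ and $c_n$ are regular and $a_n$ is $(b_n,c_n)$-invertible. Suppose that $a_n\to a$ in norm. Then the following statements are equivalent (all limits in norm, as $n\to\infty$): (i) $a_n^{-(b_n,c_n)}\to a^{-(b,c)}$; (ii) $a_n^{-(b_n,c_n)}a_n\to a^{-(b,c)}a$ and $c_n^\dagger c_n\to c^\dagger c$; (iii) $a_na_n^{-(b_n,c_n)}\to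 aa^{-(b,c)}$ and $b_nb_n^\dagger\to bb^\dagger$; (iv) $b_nb_n^\dagger\to bb^\dagger$ and $c_n^\dagger c_n\to c^\dagger c$. In addition, if $b_n\to b$, then (iii) is equivalent to (v) $a_na_n^{-(b_n,c_n)}\to aa^{-(b,c)}$ and $b_n^\dagger\to b^\dagger$. If $c_n\to c$, then (ii) is equivalent to (vi) $a_n^{-(b_n,c_n)}a_n\to a^{-(b,c)}a$ and $c_n^\dagger\to c^\dagger$. If both $b_n\to b$ and $c_n\to c$, then (iv) is equivalent to (vii) $b_n^\dagger\to b^\dagger$ and $c_n^\dagger\to c^\dagger$. -/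

import Mathlib

open Filter Topology

/-- `x` is (von Neumann) regular: it has an inner (generalized) inverse. -/
def IsVNRegular {A : Type*} [Ring A] (x : A) : Prop :=
  ∃ z : A, x = x * z * x

/-- `y` is a `(b, c)`-inverse of `a`: `y ∈ bAy ∩ yAc`, `b = yab` and `c = cay`. -/
structure IsBCInverse {A : Type*} [Ring A] (a b c y : A) : Prop where
  mem_left : ∃ u : A, y = b * u * y
  mem_right : ∃ v : A, y = y * v * c
  eq_left : b = y * a * b
  eq_right : c = c * a * y

/-- `a` is `(b, c)`-invertible. -/
def IsBCInvertible {A : Type*} [Ring A] (a b c : A) : Prop :=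
  ∃ y : A, IsBCInverse a b c y

theorem IsBCInverse.unique {A : Type*} [Ring A] {a b c y z : A}
    (hy : IsBCInverse a b c y) (hz : IsBCInverse a b c z) : y = z := by
  obtain ⟨u, hu⟩ := hy.mem_left
  obtain ⟨v, hv⟩ := hz.mem_right
  have h1 : y = z * a * y := by
    calc y = b * u * y := hu
      _ = z * a * b * u * y := by rw [← hz.eq_left]
      _ = z * a * (b * u * y) := by simp only [mul_assoc]
      _ = z * a * y := by rw [← hu]
  have h2 : z = z * a * y := by
    calc z = z * v * c := hv
      _ = z * v * (c * a * y) := by rw [← hy.eq_right]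
      _ = z * v * c * a * y := by simp only [mul_assoc]
      _ = z * a * y := by rw [← hv]
  exact h1.trans h2.symm

open Classical in
/-- The `(b, c)`-inverse of `a`, written `a^{-(b, c)}` on paper
(with the value `0` if `a` is not `(b, c)`-invertible). -/
noncomputable def bcInv {A : Type*} [Ring A] (a b c : A) : A :=
  if h : IsBCInvertible a b c then h.choose else 0

theorem IsBCInvertible.isBCInverse_bcInv {A : Type*} [Ring A] {a b c : A}
    (h : IsBCInvertible a b c) : IsBCInverse a b c (bcInv a b c) := by
  rw [bcInv, dif_pos h]
  exact h.choose_spec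

/-- `y` is a Moore-Penrose inverse of `x`. -/
structure IsMPInverse {A : Type*} [Ring A] [StarRing A] (x y : A) : Prop where
  inner : x = x * y * x
  outer : y = y * x * y
  star_mul_left : star (x * y) = x * y
  star_mul_right : star (y * x) = y * x

/-- `x` is Moore-Penrose invertible. -/
def IsMPInvertible {A : Type*} [Ring A] [StarRing A] (x : A) : Prop :=
  ∃ y : A, IsMPInverse x y

theorem IsMPInverse.unique {A : Type*} [Ring A] [StarRing A] {x y z : A}
    (hy : IsMPInverse x y) (hz : IsMPInverse x z) : y = z := by
  have e1 : x * y = x * z := by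
    calc x * y = star (x * y) := hy.star_mul_left.symm
      _ = star (x * z * (x * y)) := by rw [← mul_assoc (x * z) x y, ← hz.inner]
      _ = x * y * (x * z) := by rw [star_mul, hy.star_mul_left, hz.star_mul_left]
      _ = x * z := by rw [← mul_assoc, ← hy.inner]
  have e2 : y * x = z * x := by
    calc y * x = star (y * x) := hy.star_mul_right.symm
      _ = star (y * x * (z * x)) := by
          rw [mul_assoc y x (z * x), ← mul_assoc x z x, ← hz.inner]
      _ = z * x * (y * x) := by rw [star_mul, hy.star_mul_right, hz.star_mul_right]
      _ = z * x := by rw [mul_assoc z x (y * x), ← mul_assoc x y x, ← hy.inner]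
  calc y = y * x * y := hy.outer
    _ = z * x * y := by rw [e2]
    _ = z * (x * y) := mul_assoc _ _ _
    _ = z * (x * z) := by rw [e1]
    _ = z * x * z := (mul_assoc _ _ _).symm
    _ = z := hz.outer.symm

open Classical in
/-- The Moore-Penrose inverse of `x`, written `x†` on paper
(with the value `0` if `x` is not Moore-Penrose invertible). -/
noncomputable def mpInv {A : Type*} [Ring A] [StarRing A] (x : A) : A :=
  if h : IsMPInvertible x then h.choose else 0

theorem IsMPInvertible.isMPInverse_mpInv {A : Type*} [Ring A] [StarRing A] {x : A}
    (h : IsMPInvertible x) : IsMPInverse x (mpInv x) := by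
  rw [mpInv, dif_pos h]
  exact h.choose_spec

theorem isUnit_one_add_star_mul_self_aux {A : Type*} [CStarAlgebra A] (y : A) :
    IsUnit (1 + star y * y) := by
  by_contra hu
  have h1 : (-1 : ℝ) ∈ spectrum ℝ (star y * y) := by
    rw [spectrum.mem_iff, map_neg, map_one]
    intro h
    apply hu
    have h' := h.neg
    rwa [neg_sub, sub_neg_eq_add, add_comm] at h'
  have := spectrum_star_mul_self_nonneg (b := y) (-1) h1
  linarith

/-- Every idempotent `p` of a C*-algebra shares its right ideal with a projection. -/
theorem exists_projection_of_idempotent_aux {A : Type*} [CStarAlgebra A] {p : A}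
    (hp : p * p = p) : ∃ e : A, star e = e ∧ e * p = p ∧ p * e = e := by
  have hs : star p * star p = star p := by rw [← star_mul, hp]
  have hu := isUnit_one_add_star_mul_self_aux (star p - p)
  obtain ⟨z, hz⟩ := hu
  have hz' : (z : A) = 1 + p * star p - p - star p + star p * p := by
    rw [hz, star_sub, star_star, sub_mul, mul_sub, mul_sub, hp, hs]; abel
  have c1 : (z : A) * p = p * star p * p := by
    rw [hz']; simp only [add_mul, sub_mul, one_mul, mul_assoc, hp]; abel
  have c2 : p * (z : A) = p * star p * p := by
    rw [hz']; simp only [mul_add, mul_sub, mul_one, ← mul_assoc, hp]; abel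
  have hzs : star (z : A) = z := by
    rw [hz]; simp
  have d1 : Commute (z : A) p := c1.trans c2.symm
  have d2 : Commute (z : A) (star p) := by
    have := congrArg star d1.eq
    rw [star_mul, star_mul, hzs] at this
    exact this.symm
  have d1' : Commute (↑z⁻¹ : A) p := d1.units_inv_left
  have d2' : Commute (↑z⁻¹ : A) (star p) := d2.units_inv_left
  have hzi : star (↑z⁻¹ : A) = ↑z⁻¹ := by
    have : star (↑z⁻¹ : A) * z = 1 := by
      conv_lhs => rw [← hzs]
      rw [← star_mul]; simp
    exact left_inv_eq_right_inv this z.mul_inv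
  refine ⟨p * star p * ↑z⁻¹, ?_, ?_, ?_⟩
  · rw [star_mul, star_mul, star_star, hzi, (d1'.mul_right d2').eq]
  · rw [mul_assoc, d1'.eq, ← mul_assoc, ← c2, Units.mul_inv_cancel_right]
  · rw [← mul_assoc, ← mul_assoc, hp]

/-- In a C*-algebra the regular elements are exactly the Moore-Penrose invertible ones, so that
`mpInv x` is the genuine Moore-Penrose inverse of every regular `x`. -/
theorem isMPInvertible_iff_isVNRegular {A : Type*} [CStarAlgebra A] {x : A} :
    IsMPInvertible x ↔ IsVNRegular x := by
  refine ⟨fun ⟨y, hy⟩ => ⟨y, hy.inner⟩, fun ⟨y, hy⟩ => ?_⟩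
  obtain ⟨e, he, hep, hpe⟩ := exists_projection_of_idempotent_aux (p := x * y)
    (by rw [← mul_assoc, ← hy])
  have hq : y * x * (y * x) = y * x := by rw [mul_assoc, ← mul_assoc x, ← hy]
  obtain ⟨f, hf, hfq, hqf⟩ := exists_projection_of_idempotent_aux (p := star (y * x))
    (by rw [← star_mul, hq])
  have hqf' : y * x * f = y * x := by simpa [hf, mul_assoc] using congrArg star hfq
  have hfq' : f * (y * x) = f := by simpa [hf, mul_assoc] using congrArg star hqf
  have hxf : x * f = x := by
    calc x * f = x * (y * x * f) := by rw [← mul_assoc, ← mul_assoc x y x, ← hy]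
      _ = x := by rw [hqf', ← mul_assoc, ← hy]
  have hex : e * x = x := by
    calc e * x = e * (x * y) * x := by rw [mul_assoc e, ← hy]
      _ = x := by rw [hep, ← hy]
  have h1 : x * (f * y * e) = e := by rw [← mul_assoc, ← mul_assoc, hxf, hpe]
  have h2 : f * y * e * x = f := by rw [mul_assoc, hex, mul_assoc, hfq']
  have hff : f * f = f := by
    calc f * f = f * (y * x) * f := by rw [hfq']
      _ = f := by rw [mul_assoc, hqf', hfq']
  exact ⟨f * y * e, by rw [h1, hex], by rw [h2, ← mul_assoc, ← mul_assoc, hff],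
    by rw [h1, he], by rw [h2, hf]⟩

/-!
Write `y = a^{-(b,c)}`, and let `p = b b†`, `q = c† c` be the range projection of `b` and the
source projection of `c`. Then `y` has the same right ideal as `p` and the same left ideal as `q`,
which amounts to `p y = y = y q`, `y a p = p` and `q a y = q`
(`IsBCInverse.isBCInverse_projections` and the lemmas after it).

* The idempotent `y a` has range projection `p`, and range projections depend continuously on
  idempotents: `‖p' - p‖ ≤ 2 ‖f' - f‖` (`IsStarProjection.norm_sub_le`). Hence convergence of
  `yₙ aₙ` forces convergence of `pₙ`, and, after taking adjoints, convergence of `aₙ yₙ` forces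
  that of `qₙ`. So the first three conditions each imply that both `pₙ → p` and `qₙ → q`.
* Conversely, `y` is the inverse of `q a p` between the corners cut out by `p` and `q`, so that
  `y' (1 - (q' - q) - (q a p - q' a' p') y) = p' y`. The second factor on the left tends to `1`
  as `(a', p', q') → (a, p, q)`, and solving for `y'` gives `y' → y`
  (`IsBCInverse.tendsto_of_tendsto_projections`).
* If `bₙ → b`, then `bₙ† (bₙ bₙ* + 1 - bₙ bₙ†) = bₙ*`, where `b b* + 1 - b b†` is invertible.
  So `bₙ† → b†` as soon as `bₙ bₙ† → b b†` (`IsMPInverse.tendsto_of_tendsto_mul`); the statement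
  for `c` follows on passing to `c*`. So convergence of `bₙ bₙ†` (or of
  `cₙ† cₙ`) may be traded for that of `bₙ†` (or `cₙ†`) whenever `bₙ → b` (or `cₙ → c`).
-/

/-! ### Limits obtained by cancelling an invertible factor -/

/-- If `xₙ sₙ` tends to `x s` and `sₙ` tends to a unit `s`, then `xₙ` tends to `x`. -/
theorem tendsto_of_tendsto_mul_of_isUnit {R ι : Type*} [NormedRing R] [HasSummableGeomSeries R]
    {l : Filter ι} {x : R} {s : R} {xs ss : ι → R} (hs : IsUnit s)
    (hss : Tendsto ss l (𝓝 s)) (h : Tendsto (fun n => xs n * ss n) l (𝓝 (x * s))) :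
    Tendsto xs l (𝓝 x) := by
  obtain ⟨u, rfl⟩ := hs
  have hinv : Tendsto (fun n => Ring.inverse (ss n)) l (𝓝 (Ring.inverse (u : R))) :=
    (NormedRing.inverse_continuousAt u).tendsto.comp hss
  have hprod := h.mul hinv
  rw [Ring.mul_inverse_cancel_right _ _ u.isUnit] at hprod
  refine hprod.congr' ?_
  filter_upwards [hss.eventually (Units.isOpen.mem_nhds u.isUnit)] with n hn
  exact Ring.mul_inverse_cancel_right _ _ hn

/-! ### Range projections of idempotents -/

/-- The range projection of an idempotent is a Lipschitz function of the idempotent. -/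
theorem IsStarProjection.norm_sub_le {A : Type*} [CStarAlgebra A] {p p' f f' : A}
    (hp : IsStarProjection p) (hp' : IsStarProjection p')
    (hpf : p * f = f) (hfp : f * p = p) (hpf' : p' * f' = f') (hfp' : f' * p' = p') :
    ‖p' - p‖ ≤ 2 * ‖f' - f‖ := by
  -- The part of one projection off the range of the other is controlled by `f' - f`.
  have key : ∀ {p p' f f' : A}, IsStarProjection p → IsStarProjection p' → p * f = f →
      p' * f' = f' → f' * p' = p' → ‖(1 - p) * p'‖ ≤ ‖f' - f‖ := by
    intro p p' f f' hp hp' hpf hpf' hfp'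
    have h : (1 - p) * p' = (1 - p) * (f' - f) * p' := by
      have h0 : (1 - p) * f = 0 := by rw [sub_mul, one_mul, hpf, sub_self]
      rw [mul_sub, h0, sub_zero, mul_assoc, hfp']
    calc ‖(1 - p) * p'‖ = ‖(1 - p) * (f' - f) * p'‖ := by rw [← h]
      _ ≤ ‖1 - p‖ * ‖f' - f‖ * ‖p'‖ := norm_mul₃_le
      _ ≤ 1 * ‖f' - f‖ * 1 := by
        gcongr
        · exact hp.one_sub.norm_le
        · exact hp'.norm_le
      _ = ‖f' - f‖ := by ring
  have h1 := key hp hp' hpf hpf' hfp'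
  have h2 : ‖p * (1 - p')‖ ≤ ‖f' - f‖ := by
    rw [← norm_star, star_mul, hp.isSelfAdjoint.star_eq, hp'.one_sub.isSelfAdjoint.star_eq,
      norm_sub_rev f']
    exact key hp' hp hpf' hpf hfp
  calc ‖p' - p‖ = ‖(1 - p) * p' - p * (1 - p')‖ := by congr 1; noncomm_ring
    _ ≤ ‖(1 - p) * p'‖ + ‖p * (1 - p')‖ := _root_.norm_sub_le _ _
    _ ≤ 2 * ‖f' - f‖ := by linarith

theorem tendsto_range_projection {A ι : Type*} [CStarAlgebra A] {l : Filter ι} {p f : A}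
    {ps fs : ι → A} (hp : IsStarProjection p) (hps : ∀ n, IsStarProjection (ps n))
    (hpf : p * f = f) (hfp : f * p = p) (hpfs : ∀ n, ps n * fs n = fs n)
    (hfps : ∀ n, fs n * ps n = ps n) (hf : Tendsto fs l (𝓝 f)) : Tendsto ps l (𝓝 p) := by
  rw [tendsto_iff_norm_sub_tendsto_zero] at hf ⊢
  refine squeeze_zero (fun _ => norm_nonneg _)
    (fun n => hp.norm_sub_le (hps n) hpf hfp (hpfs n) (hfps n)) ?_
  simpa using hf.const_mul 2

/-! ### Moore–Penrose inverses -/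

namespace IsMPInverse

theorem isStarProjection_mul {A : Type*} [Ring A] [StarRing A] {x y : A}
    (h : IsMPInverse x y) : IsStarProjection (x * y) :=
  ⟨by rw [IsIdempotentElem, ← mul_assoc, ← h.inner], h.star_mul_left⟩

theorem isStarProjection_mul' {A : Type*} [Ring A] [StarRing A] {x y : A}
    (h : IsMPInverse x y) : IsStarProjection (y * x) :=
  ⟨by rw [IsIdempotentElem, ← mul_assoc, ← h.outer], h.star_mul_right⟩

theorem star {A : Type*} [Ring A] [StarRing A] {x y : A}
    (h : IsMPInverse x y) : IsMPInverse (star x) (star y) where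
  inner := by rw [mul_assoc, ← star_mul, ← star_mul, ← h.inner]
  outer := by rw [mul_assoc, ← star_mul, ← star_mul, ← h.outer]
  star_mul_left := by rw [← star_mul, h.star_mul_right, h.star_mul_right]
  star_mul_right := by rw [← star_mul, h.star_mul_left, h.star_mul_left]

/-- The element `x x* + 1 - x x†` is invertible, with inverse `(x†)* x† + 1 - x x†`. -/
theorem isUnit_mul_star_add {A : Type*} [Ring A] [StarRing A] {x y : A}
    (h : IsMPInverse x y) : IsUnit (x * Star.star x + (1 - x * y)) := by
  have hx : Star.star x * (x * y) = Star.star x := by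
    conv_lhs => rw [← h.star_mul_left, ← star_mul, ← h.inner]
  have hy : x * y * Star.star y = Star.star y := by
    conv_lhs => rw [← h.star_mul_left, ← star_mul, ← mul_assoc, ← h.outer]
  have hxy : x * Star.star x * (Star.star y * y) = x * y := by
    rw [mul_assoc, ← mul_assoc (Star.star x), ← star_mul, h.star_mul_right, ← mul_assoc,
      ← mul_assoc, ← h.inner]
  have hp := h.isStarProjection_mul
  have right : (x * Star.star x + (1 - x * y)) * (Star.star y * y + (1 - x * y)) = 1 := by
    have h1 : x * Star.star x * (1 - x * y) = 0 := by
      rw [mul_assoc, mul_sub, mul_one, hx, sub_self, mul_zero]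
    have h2 : (1 - x * y) * (Star.star y * y) = 0 := by
      rw [← mul_assoc, sub_mul, one_mul, hy, sub_self, zero_mul]
    rw [add_mul, mul_add, mul_add, hxy, h1, h2, hp.one_sub.isIdempotentElem.eq]
    abel
  -- Both factors are self-adjoint, so the adjoint of this identity is the other half.
  have left : (Star.star y * y + (1 - x * y)) * (x * Star.star x + (1 - x * y)) = 1 := by
    have := congrArg Star.star right
    simpa only [star_mul, star_add, star_sub, star_one, star_star,
      hp.isSelfAdjoint.star_eq, ← h.star_mul_left.symm] using this
  exact ⟨⟨_, _, right, left⟩, rfl⟩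

theorem mul_mul_star_add {A : Type*} [Ring A] [StarRing A] {x y : A}
    (h : IsMPInverse x y) : y * (x * Star.star x + (1 - x * y)) = Star.star x := by
  have h1 : y * x * Star.star x = Star.star x := by
    conv_lhs => rw [← h.star_mul_right, ← star_mul, ← mul_assoc, ← h.inner]
  rw [mul_add, mul_sub, mul_one, ← mul_assoc, ← mul_assoc, ← h.outer, h1, sub_self, add_zero]

/-- If `xₙ → x`, then convergence of the range projections `xₙ xₙ†` already forces that of the
Moore–Penrose inverses. -/
theorem tendsto_of_tendsto_mul {A ι : Type*} [CStarAlgebra A] {l : Filter ι} {x y : A}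
    {xs ys : ι → A} (h : IsMPInverse x y) (hs : ∀ n, IsMPInverse (xs n) (ys n))
    (hx : Tendsto xs l (𝓝 x)) (hxy : Tendsto (fun n => xs n * ys n) l (𝓝 (x * y))) :
    Tendsto ys l (𝓝 y) := by
  refine tendsto_of_tendsto_mul_of_isUnit h.isUnit_mul_star_add
    ((hx.mul hx.star).add (hxy.const_sub 1)) ?_
  simp only [h.mul_mul_star_add, (hs _).mul_mul_star_add]
  exact hx.star

theorem tendsto_of_tendsto_mul' {A ι : Type*} [CStarAlgebra A] {l : Filter ι} {x y : A}
    {xs ys : ι → A} (h : IsMPInverse x y) (hs : ∀ n, IsMPInverse (xs n) (ys n))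
    (hx : Tendsto xs l (𝓝 x)) (hyx : Tendsto (fun n => ys n * xs n) l (𝓝 (y * x))) :
    Tendsto ys l (𝓝 y) := by
  have key := h.star.tendsto_of_tendsto_mul (fun n => (hs n).star) hx.star
    (by simpa only [← star_mul] using hyx.star)
  simpa only [star_star] using key.star

end IsMPInverse

/-! ### The `(b, c)`-inverse in terms of projections -/

namespace IsBCInverse

/-- Only the right ideal of `b` and the left ideal of `c` matter for the `(b, c)`-inverse, so `b`
and `c` may be replaced by the projections `b b†` and `c† c`. -/
theorem isBCInverse_projections {A : Type*} [Ring A] [StarRing A] {a b c y b' c' : A}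
    (h : IsBCInverse a b c y) (hb : IsMPInverse b b') (hc : IsMPInverse c c') :
    IsBCInverse a (b * b') (c' * c) y where
  mem_left := by
    obtain ⟨u, hu⟩ := h.mem_left
    exact ⟨b * u, by rw [← mul_assoc, ← hb.inner, ← hu]⟩
  mem_right := by
    obtain ⟨v, hv⟩ := h.mem_right
    exact ⟨v * c, by rw [mul_assoc, mul_assoc, ← mul_assoc c, ← hc.inner, ← mul_assoc, ← hv]⟩
  eq_left := by rw [← mul_assoc, ← h.eq_left]
  eq_right := by rw [mul_assoc, mul_assoc, ← mul_assoc c, ← h.eq_right]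

theorem mul_eq_of_isIdempotentElem {A : Type*} [Ring A] {a p q y : A}
    (h : IsBCInverse a p q y) (hp : IsIdempotentElem p) : p * y = y := by
  obtain ⟨u, hu⟩ := h.mem_left
  rw [hu, ← mul_assoc, ← mul_assoc, hp.eq]

theorem mul_eq_of_isIdempotentElem' {A : Type*} [Ring A] {a p q y : A}
    (h : IsBCInverse a p q y) (hq : IsIdempotentElem q) : y * q = y := by
  obtain ⟨v, hv⟩ := h.mem_right
  rw [hv, mul_assoc, hq.eq]

variable {A ι : Type*} [CStarAlgebra A] {l : Filter ι} {a p q y : A} {as ps qs ys : ι → A}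

/-- `p` is the range projection of the idempotent `y a`. -/
theorem tendsto_left_projection (h : IsBCInverse a p q y) (hp : IsStarProjection p)
    (hs : ∀ n, IsBCInverse (as n) (ps n) (qs n) (ys n)) (hps : ∀ n, IsStarProjection (ps n))
    (hya : Tendsto (fun n => ys n * as n) l (𝓝 (y * a))) : Tendsto ps l (𝓝 p) := by
  refine tendsto_range_projection hp hps ?_ h.eq_left.symm (fun n => ?_)
    (fun n => (hs n).eq_left.symm) hya
  · rw [← mul_assoc, h.mul_eq_of_isIdempotentElem hp.isIdempotentElem]
  · rw [← mul_assoc, (hs n).mul_eq_of_isIdempotentElem (hps n).isIdempotentElem]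

/-- `q` is the range projection of the idempotent `(a y)*`. -/
theorem tendsto_right_projection (h : IsBCInverse a p q y) (hq : IsStarProjection q)
    (hs : ∀ n, IsBCInverse (as n) (ps n) (qs n) (ys n)) (hqs : ∀ n, IsStarProjection (qs n))
    (hay : Tendsto (fun n => as n * ys n) l (𝓝 (a * y))) : Tendsto qs l (𝓝 q) := by
  have key : ∀ {a p q y : A}, IsBCInverse a p q y → IsStarProjection q →
      q * star (a * y) = star (a * y) ∧ star (a * y) * q = q := by
    intro a p q y h hq
    constructor
    · conv_lhs => rw [← hq.isSelfAdjoint.star_eq, ← star_mul, mul_assoc,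
        h.mul_eq_of_isIdempotentElem' hq.isIdempotentElem]
    · conv_lhs => rw [← hq.isSelfAdjoint.star_eq, ← star_mul, ← mul_assoc, ← h.eq_right]
      exact hq.isSelfAdjoint.star_eq
  exact tendsto_range_projection hq hqs (key h hq).1 (key h hq).2 (fun n => (key (hs n) (hqs n)).1)
    (fun n => (key (hs n) (hqs n)).2) hay.star

/-- The `(p, q)`-inverse of `a` is a jointly continuous function of `a` and of the projections
`p` and `q`. -/
theorem tendsto_of_tendsto_projections (h : IsBCInverse a p q y) (hp : IsStarProjection p)
    (hs : ∀ n, IsBCInverse (as n) (ps n) (qs n) (ys n)) (hqs : ∀ n, IsStarProjection (qs n))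
    (ha : Tendsto as l (𝓝 a)) (hpl : Tendsto ps l (𝓝 p)) (hql : Tendsto qs l (𝓝 q)) :
    Tendsto ys l (𝓝 y) := by
  have hpy := h.mul_eq_of_isIdempotentElem hp.isIdempotentElem
  have hss : Tendsto (fun n => 1 - (qs n - q) - (q * a * p - qs n * as n * ps n) * y) l (𝓝 1) := by
    simpa using ((hql.sub_const q).const_sub 1).sub
      ((((hql.mul ha).mul hpl).const_sub (q * a * p)).mul_const y)
  refine tendsto_of_tendsto_mul_of_isUnit isUnit_one hss ?_
  have hys : ∀ n, ys n * (1 - (qs n - q) - (q * a * p - qs n * as n * ps n) * y) = ps n * y := by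
    intro n
    have h1 := (hs n).mul_eq_of_isIdempotentElem' (hqs n).isIdempotentElem
    have h2 : q * a * p * y = q := by rw [mul_assoc, hpy, ← h.eq_right]
    have h3 : ys n * (qs n * as n * ps n * y) = ps n * y := by
      rw [← mul_assoc, ← mul_assoc, ← mul_assoc, h1, ← (hs n).eq_left]
    rw [sub_mul, h2, mul_sub, mul_sub, mul_sub, mul_sub, h3, h1, mul_one]
    abel
  simp only [hys, mul_one]
  simpa only [hpy] using hpl.mul_const y

end IsBCInverse

/-! ### Continuity of the `(b, c)`-inverse -/

theorem theorem5p6 {A : Type*} [CStarAlgebra A] (a b c : A) (as bs cs : ℕ → A)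
    (hb : IsVNRegular b) (hc : IsVNRegular c)
    (hinv : IsBCInvertible a b c) (hne : bcInv a b c ≠ 0)
    (hbs : ∀ n, IsVNRegular (bs n)) (hcs : ∀ n, IsVNRegular (cs n))
    (hinvs : ∀ n, IsBCInvertible (as n) (bs n) (cs n))
    (ha : Tendsto as atTop (𝓝 a)) :
    List.TFAE [
      Tendsto (fun n => bcInv (as n) (bs n) (cs n)) atTop (𝓝 (bcInv a b c)),
      Tendsto (fun n => bcInv (as n) (bs n) (cs n) * as n) atTop (𝓝 (bcInv a b c * a)) ∧
        Tendsto (fun n => mpInv (cs n) * cs n) atTop (𝓝 (mpInv c * c)),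
      Tendsto (fun n => as n * bcInv (as n) (bs n) (cs n)) atTop (𝓝 (a * bcInv a b c)) ∧
        Tendsto (fun n => bs n * mpInv (bs n)) atTop (𝓝 (b * mpInv b)),
      Tendsto (fun n => bs n * mpInv (bs n)) atTop (𝓝 (b * mpInv b)) ∧
        Tendsto (fun n => mpInv (cs n) * cs n) atTop (𝓝 (mpInv c * c))] ∧
    (Tendsto bs atTop (𝓝 b) →
      ((Tendsto (fun n => as n * bcInv (as n) (bs n) (cs n)) atTop (𝓝 (a * bcInv a b c)) ∧
          Tendsto (fun n => bs n * mpInv (bs n)) atTop (𝓝 (b * mpInv b))) ↔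
        (Tendsto (fun n => as n * bcInv (as n) (bs n) (cs n)) atTop (𝓝 (a * bcInv a b c)) ∧
          Tendsto (fun n => mpInv (bs n)) atTop (𝓝 (mpInv b))))) ∧
    (Tendsto cs atTop (𝓝 c) →
      ((Tendsto (fun n => bcInv (as n) (bs n) (cs n) * as n) atTop (𝓝 (bcInv a b c * a)) ∧
          Tendsto (fun n => mpInv (cs n) * cs n) atTop (𝓝 (mpInv c * c))) ↔
        (Tendsto (fun n => bcInv (as n) (bs n) (cs n) * as n) atTop (𝓝 (bcInv a b c * a)) ∧
          Tendsto (fun n => mpInv (cs n)) atTop (𝓝 (mpInv c))))) ∧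
    (Tendsto bs atTop (𝓝 b) → Tendsto cs atTop (𝓝 c) →
      ((Tendsto (fun n => bs n * mpInv (bs n)) atTop (𝓝 (b * mpInv b)) ∧
          Tendsto (fun n => mpInv (cs n) * cs n) atTop (𝓝 (mpInv c * c))) ↔
        (Tendsto (fun n => mpInv (bs n)) atTop (𝓝 (mpInv b)) ∧
          Tendsto (fun n => mpInv (cs n)) atTop (𝓝 (mpInv c))))) := by
  have hB := (isMPInvertible_iff_isVNRegular.2 hb).isMPInverse_mpInv
  have hC := (isMPInvertible_iff_isVNRegular.2 hc).isMPInverse_mpInv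
  have hBs := fun n => (isMPInvertible_iff_isVNRegular.2 (hbs n)).isMPInverse_mpInv
  have hCs := fun n => (isMPInvertible_iff_isVNRegular.2 (hcs n)).isMPInverse_mpInv
  have hY := hinv.isBCInverse_bcInv.isBCInverse_projections hB hC
  have hYs := fun n => (hinvs n).isBCInverse_bcInv.isBCInverse_projections (hBs n) (hCs n)
  have hp := hB.isStarProjection_mul
  have hq := hC.isStarProjection_mul'
  have hps := fun n => (hBs n).isStarProjection_mul
  have hqs := fun n => (hCs n).isStarProjection_mul'
  have mp_b : Tendsto bs atTop (𝓝 b) →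
      (Tendsto (fun n => bs n * mpInv (bs n)) atTop (𝓝 (b * mpInv b)) ↔
        Tendsto (fun n => mpInv (bs n)) atTop (𝓝 (mpInv b))) :=
    fun h => ⟨hB.tendsto_of_tendsto_mul hBs h, h.mul⟩
  have mp_c : Tendsto cs atTop (𝓝 c) →
      (Tendsto (fun n => mpInv (cs n) * cs n) atTop (𝓝 (mpInv c * c)) ↔
        Tendsto (fun n => mpInv (cs n)) atTop (𝓝 (mpInv c))) :=
    fun h => ⟨hC.tendsto_of_tendsto_mul' hCs h, fun h' => h'.mul h⟩
  refine ⟨?_, fun h => and_congr_right' (mp_b h), fun h => and_congr_right' (mp_c h),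
    fun h h' => and_congr (mp_b h) (mp_c h')⟩
  tfae_have 1 → 2 := fun h => ⟨h.mul ha, hY.tendsto_right_projection hq hYs hqs (ha.mul h)⟩
  tfae_have 1 → 3 := fun h => ⟨ha.mul h, hY.tendsto_left_projection hp hYs hps (h.mul ha)⟩
  tfae_have 2 → 4 := fun h => ⟨hY.tendsto_left_projection hp hYs hps h.1, h.2⟩
  tfae_have 3 → 4 := fun h => ⟨h.2, hY.tendsto_right_projection hq hYs hqs h.1⟩
  tfae_have 4 → 1 := fun h => hY.tendsto_of_tendsto_projections hp hYs hqs ha h.1 h.2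
  tfae_finish
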